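/- Let $\Gamma$ be a countably infinite discrete group acting continuously on a compact metrizable space $X$. Let $\mathcal M(X)$ be the space of Borel probability measures on $X$ with the weak$^*$-topology, viewed as a subset of the dual $C(X)^*$ of the space $C(X)$ of real-valued continuous functions, and equipped with the induced (push-forward) action of $\Gamma$; identify $x\in X$ with the Dirac measure $\delta_x\in\mathcal M(X)$. Let $k\geq 1$ be an integer and let $\Gamma$ act continuously on a compact metrizable space $Y$. A set $F\subseteq\Gamma$ is an independence set for a tuple $(A_1,\dots,A_k)$ of subsets of $Y$ if $\bigcap_{s\in J}s^{-1}A_{\sigma(s)}\neq\emptyset$ for every nonempty finite $J\subseteq F$ and every $\sigma:J\to\{1,\dots,k\}$. A tuple $(y_1,\dots,y_k)\in Y^k$ is an IT-tuple if for all neighborhoods $U_1,\dots,U_k$ of $y_1,\dots,y_k$ respectively, $(U_1,\dots,U_k)$ has an infinite independence set. Let $\mathrm{IT}_k(Y)\subseteq Y^k$ be the set of IT-tuples of length $k$. For $\mu\in\mathcal M(X^k)$ let $\mu^{(j)}\in\mathcal M(X)$ be its push-forward under the $j$-th coordinate map. Let $\mathcal M_{\mathrm{IT}}(X^k)$ be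 the set of IT-measures, that is, of those $\mu\in\mathcal M(X^k)$ such that for every integer $n\geq 1$ and all points $(x^{(i)}_1,\dots,x^{(i)}_k)\in\mathrm{supp}(\mu)$, $1\le i\le n$, one has $$\big((x_1^{(1)},\dots,x_1^{(n)}),\dots,(x_k^{(1)},\dots,x_k^{(n)})\big)\in\mathrm{IT}_k(X^n),$$ where $\Gamma$ acts diagonally on $X^n$. Then for every integer $k\geq 1$ the following hold: 1. $\mathrm{IT}_k(\mathcal M(X))$ is contained in the closed convex hull of $\mathrm{IT}_k(X)$ in $\mathcal M(X)^k\subseteq (C(X)^*)^{k}$. 2. $\mathrm{IT}_k(\mathcal M(X))\cap X^k=\mathrm{IT}_k(X)$. 3. $\mathrm{IT}_k(\mathcal M(X))=\{(\mu^{(1)},\dots,\mu^{(k)}):\mu\in\mathcal M_{\mathrm{IT}}(X^k)\}$. -/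

import Mathlib

open MeasureTheory Topology

section Independence

variable {Γ : Type*} {Y : Type*}

/-- `F ⊆ Γ` is an independence set for the tuple `A = (A 1, …, A k)` of subsets of `Y`:
`⋂_{s ∈ J} s⁻¹ A (σ s) ≠ ∅` for every nonempty finite `J ⊆ F` and every map `σ` from `J` to the
index set, where `s⁻¹ B = {y | s • y ∈ B}`. -/
def IsIndependenceSet [SMul Γ Y] {k : ℕ} (A : Fin k → Set Y) (F : Set Γ) : Prop :=
  ∀ J : Finset Γ, J.Nonempty → (J : Set Γ) ⊆ F → ∀ σ : J → Fin k,
    (⋂ s : J, (fun y : Y => (s : Γ) • y) ⁻¹' A (σ s)).Nonempty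

variable (Γ Y) in
/-- The set `IT_k(Y)` of IT-tuples of length `k` for the action of `Γ` on `Y`. -/
def ITTuples [SMul Γ Y] [TopologicalSpace Y] (k : ℕ) : Set (Fin k → Y) :=
  {x | ∀ U : Fin k → Set Y, (∀ j, U j ∈ 𝓝 (x j)) →
    ∃ F : Set Γ, F.Infinite ∧ IsIndependenceSet U F}

end Independence

section Measures

variable {Γ : Type*} {X : Type*} [MeasurableSpace X]

/-- The induced action on Borel probability measures: `s • μ` is the push-forward of `μ` under
`x ↦ s • x`. -/
noncomputable instance probabilityMeasureMulAction [Group Γ] [MulAction Γ X]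
    [MeasurableConstSMul Γ X] : MulAction Γ (ProbabilityMeasure X) where
  smul s μ := μ.map (f := fun x => s • x) (measurable_const_smul s).aemeasurable
  one_smul μ := by
    apply ProbabilityMeasure.toMeasure_injective
    change Measure.map (fun x => (1 : Γ) • x) (μ : Measure X) = μ
    simp
  mul_smul s t μ := by
    apply ProbabilityMeasure.toMeasure_injective
    change Measure.map (fun x => (s * t) • x) (μ : Measure X) =
      Measure.map (fun x => s • x) (Measure.map (fun x => t • x) (μ : Measure X))
    rw [Measure.map_map (measurable_const_smul s) (measurable_const_smul t)]
    simp only [mul_smul]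
    rfl

/-- `μ^{(j)}`: the push-forward of a probability measure `μ` on `X^k` under the `j`-th coordinate
map. -/
noncomputable def marginal {k : ℕ} (μ : ProbabilityMeasure (Fin k → X)) (j : Fin k) :
    ProbabilityMeasure X :=
  μ.map (f := fun x => x j) (measurable_pi_apply j).aemeasurable

variable (Γ X) in
/-- The set of IT-measures on `X^k`: those `μ` such that, for any finitely many points
`x i = (x i 1, …, x i k)`, `i ∈ [n]`, of the support of `μ`, the `k`-tuple of points of `X^n`
whose `j`-th entry is `(x 1 j, …, x n j)` is an IT-tuple for the diagonal action on `X^n`. -/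
def ITMeasures [TopologicalSpace X] [SMul Γ X] (k : ℕ) :
    Set (ProbabilityMeasure (Fin k → X)) :=
  {μ | ∀ n : ℕ, 1 ≤ n → ∀ x : Fin n → Fin k → X,
    (∀ i, x i ∈ (μ : Measure (Fin k → X)).support) →
      (fun (j : Fin k) (i : Fin n) => x i j) ∈ ITTuples Γ (Fin n → X) k}

/-- A Borel probability measure on `X` as an element `f ↦ ∫ f dμ` of the dual of `C(X)`, with the
weak-* topology. -/
noncomputable def toDualC [TopologicalSpace X] [CompactSpace X] [BorelSpace X]
    (μ : ProbabilityMeasure X) : WeakDual ℝ C(X, ℝ) :=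
  StrongDual.toWeakDual <| LinearMap.mkContinuous
    { toFun := fun f : C(X, ℝ) => ∫ x, f x ∂(μ : Measure X)
      map_add' := fun f g => by
        simpa using integral_add
          (f.continuous.integrable_of_hasCompactSupport (HasCompactSupport.of_compactSpace _))
          (g.continuous.integrable_of_hasCompactSupport (HasCompactSupport.of_compactSpace _))
      map_smul' := fun c f => by
        simpa using integral_const_mul c (fun x => f x) }
    1 (fun f => by
      simpa using norm_integral_le_of_norm_le_const (μ := (μ : Measure X))
        (Filter.Eventually.of_forall fun x => f.norm_coe_le_norm x))

end Measures

/-! ### IT-tuples: closedness and functoriality. -/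

section IT

variable {Γ Y Z : Type*} [TopologicalSpace Y] [TopologicalSpace Z]

/-! Everything rests on the third claim, that the IT-tuples of measures are the marginal tuples of
IT-measures.

Marginals of an IT-measure `μ` form an IT-tuple: by the law of large numbers `μ` is a limit of
empirical measures of points of its support. Their marginals are the image of an IT-tuple of a power
of `X` under the continuous equivariant averaging map, and IT-tuples form a closed set
(`marginal_mem_ITTuples`).

Conversely, IT-measures form a compact set, so it suffices to approximate. Independence gives `s l`
such that every finite colouring `v` has a measure whose translate by `s l` is close to the measure
of colour `v l`. A weak limit assembles these into `Θ` on colourings times `X`, with uniform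
Bernoulli first marginal (`exists_coupling`). The events "`l` has colour `j`" are pairwise
independent in `l`, so `Θ` conditioned on them tends to `Θ`, and the random point `s l • x`
converges stably to a random measure `κ j`. Averaging the products `∏ j, κ j ω` over `Θ` gives a
measure with almost the prescribed marginals. It is an IT-measure because, by stability, a
positive-measure event on which `κ j` charges an open set still meets "`s l • x` lies in that set"
for many `l`, so that independence sets grow one element at a time (`mixture_mem_ITMeasures`).

The hull claim follows by the same empirical approximation. For the Dirac claim, a measure with
Dirac marginals has the corresponding point in its support. -/

theorem isClosed_ITTuples [SMul Γ Y] (k : ℕ) : IsClosed (ITTuples Γ Y k) := by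
  refine isClosed_of_closure_subset fun x hx U hU => ?_
  have hV : Set.pi Set.univ (fun j => interior (U j)) ∈ 𝓝 x :=
    set_pi_mem_nhds Set.finite_univ fun j _ => interior_mem_nhds.2 (hU j)
  obtain ⟨y, hyV, hy⟩ := mem_closure_iff_nhds.1 hx _ hV
  exact hy U fun j => mem_interior_iff_mem_nhds.1 (hyV j trivial)

theorem map_mem_ITTuples [SMul Γ Y] [SMul Γ Z] {k : ℕ} {φ : Y → Z} (hφ : Continuous φ)
    (hsmul : ∀ (s : Γ) y, φ (s • y) = s • φ y) {x : Fin k → Y} (hx : x ∈ ITTuples Γ Y k) :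
    (fun j => φ (x j)) ∈ ITTuples Γ Z k := by
  intro U hU
  obtain ⟨F, hF, hind⟩ := hx (fun j => φ ⁻¹' U j) fun j => hφ.continuousAt (hU j)
  refine ⟨F, hF, fun J hJ hJF σ => ?_⟩
  obtain ⟨y, hy⟩ := hind J hJ hJF σ
  refine ⟨φ y, Set.mem_iInter.2 fun s => ?_⟩
  have := Set.mem_iInter.1 hy s
  simpa [hsmul] using this

end IT

/-! ### The weak topology tested on continuous functions. -/

section Testing

variable {Z : Type*} [TopologicalSpace Z] [CompactSpace Z] [TopologicalSpace.MetrizableSpace Z]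
  [MeasurableSpace Z] [BorelSpace Z]

theorem ContinuousMap.integrable_of_compactSpace (μ : Measure Z) [IsFiniteMeasure μ]
    (f : C(Z, ℝ)) : Integrable f μ :=
  f.continuous.integrable_of_hasCompactSupport (HasCompactSupport.of_compactSpace _)

omit [TopologicalSpace.MetrizableSpace Z] in
theorem ProbabilityMeasure.continuous_integral_continuousMap (f : C(Z, ℝ)) :
    Continuous fun ν : ProbabilityMeasure Z => ∫ z, f z ∂(ν : Measure Z) :=
  ProbabilityMeasure.continuous_integral_boundedContinuousFunction
    (BoundedContinuousFunction.mkOfCompact f)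

omit [CompactSpace Z] in
theorem ProbabilityMeasure.ext_integral_continuousMap {μ ν : ProbabilityMeasure Z}
    (h : ∀ f : C(Z, ℝ), ∫ z, f z ∂(μ : Measure Z) = ∫ z, f z ∂(ν : Measure Z)) : μ = ν :=
  ProbabilityMeasure.toMeasure_injective <|
    ext_of_forall_integral_eq_of_IsFiniteMeasure fun f => h f.toContinuousMap

theorem ProbabilityMeasure.isInducing_integral :
    IsInducing fun (ν : ProbabilityMeasure Z) (f : C(Z, ℝ)) => ∫ z, f z ∂(ν : Measure Z) :=
  ((continuous_pi fun f => continuous_integral_continuousMap f).isClosedEmbedding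
    fun _ _ h => ext_integral_continuousMap fun f => congrFun h f).isInducing

theorem ProbabilityMeasure.continuous_iff_integral {Y : Type*} [TopologicalSpace Y]
    {φ : Y → ProbabilityMeasure Z} :
    Continuous φ ↔ ∀ f : C(Z, ℝ), Continuous fun y => ∫ z, f z ∂(φ y : Measure Z) := by
  rw [isInducing_integral.continuous_iff, continuous_pi_iff]
  rfl

theorem ProbabilityMeasure.exists_finset_of_mem_nhds {μ : ProbabilityMeasure Z}
    {V : Set (ProbabilityMeasure Z)} (hV : V ∈ 𝓝 μ) :
    ∃ (S : Finset C(Z, ℝ)) (ε : ℝ), 0 < ε ∧ ∀ ν : ProbabilityMeasure Z,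
      (∀ f ∈ S, |∫ z, f z ∂(ν : Measure Z) - ∫ z, f z ∂(μ : Measure Z)| < ε) → ν ∈ V := by
  rw [isInducing_integral.nhds_eq_comap, Filter.mem_comap] at hV
  obtain ⟨W, hW, hWV⟩ := hV
  rw [nhds_pi, Filter.mem_pi] at hW
  obtain ⟨I, hI, t, ht, htW⟩ := hW
  choose δ hδ hδt using fun f => Metric.mem_nhds_iff.1 (ht f)
  obtain ⟨ε, hε, hεδ⟩ : ∃ ε > 0, ∀ f ∈ hI.toFinset, ε ≤ δ f := by
    rcases hI.toFinset.eq_empty_or_nonempty with h | h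
    · exact ⟨1, one_pos, by simp [h]⟩
    · exact ⟨hI.toFinset.inf' h δ, (Finset.lt_inf'_iff _).2 fun f _ => hδ f,
        fun f hf => Finset.inf'_le _ hf⟩
  refine ⟨hI.toFinset, ε, hε, fun ν hν => hWV (htW fun f hf => hδt f ?_)⟩
  have hf' : f ∈ hI.toFinset := hI.mem_toFinset.2 hf
  exact Metric.mem_ball.2 ((Real.dist_eq _ _).trans_lt ((hν f hf').trans_le (hεδ f hf')))

theorem ProbabilityMeasure.exists_finset_of_mem_nhds_pi {ι : Type*} [Fintype ι]
    {μ : ι → ProbabilityMeasure Z} {V : Set (ι → ProbabilityMeasure Z)} (hV : V ∈ 𝓝 μ) :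
    ∃ (S : Finset C(Z, ℝ)) (ε : ℝ), 0 < ε ∧ ∀ ν : ι → ProbabilityMeasure Z,
      (∀ j, ∀ f ∈ S, |∫ z, f z ∂(ν j : Measure Z) - ∫ z, f z ∂(μ j : Measure Z)| < ε) →
        ν ∈ V := by
  classical
  rw [nhds_pi, Filter.mem_pi] at hV
  obtain ⟨I, hI, t, ht, htV⟩ := hV
  choose S δ hδ hS using fun j => exists_finset_of_mem_nhds (ht j)
  obtain ⟨ε, hε, hεδ⟩ : ∃ ε > 0, ∀ j, ε ≤ δ j := by
    rcases isEmpty_or_nonempty ι with h | h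
    · exact ⟨1, one_pos, fun j => h.elim j⟩
    · exact ⟨Finset.univ.inf' Finset.univ_nonempty δ, (Finset.lt_inf'_iff _).2 fun f _ => hδ f,
        fun f => Finset.inf'_le _ (Finset.mem_univ f)⟩
  refine ⟨Finset.univ.biUnion S, ε, hε, fun ν hν => htV fun j _ => hS j _ fun f hf => ?_⟩
  exact (hν j f (Finset.mem_biUnion.2 ⟨j, Finset.mem_univ j, hf⟩)).trans_le (hεδ j)

omit [CompactSpace Z] in
theorem ProbabilityMeasure.isOpen_setOf_measure_pos {W : Set Z} (hW : IsOpen W) :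
    IsOpen {μ : ProbabilityMeasure Z | 0 < (μ : Measure Z) W} := by
  rw [isOpen_iff_mem_nhds]
  intro μ hμ
  have h := ProbabilityMeasure.le_liminf_measure_open_of_tendsto (μ := μ) (L := 𝓝 μ)
    (μs := id) Filter.tendsto_id hW
  exact Filter.eventually_lt_of_lt_liminf (lt_of_lt_of_le hμ h)

end Testing

/-! ### Closedness of the set of IT-measures. -/

section ITMeasure

variable {Γ X : Type*} [TopologicalSpace X] [CompactSpace X] [TopologicalSpace.MetrizableSpace X]
  [MeasurableSpace X] [BorelSpace X]

/-- Supports are lower semicontinuous: finitely many support points of `μ` are approximated by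
support points of any nearby measure, and IT-tuples are closed. -/
theorem isClosed_ITMeasures [SMul Γ X] (k : ℕ) : IsClosed (ITMeasures Γ X k) := by
  refine isClosed_of_closure_subset fun μ hμ n hn x hx => ?_
  rw [← (isClosed_ITTuples (Γ := Γ) (Y := Fin n → X) k).closure_eq, mem_closure_iff_nhds]
  intro V hV
  have hcont : Continuous fun (y : Fin n → Fin k → X) (j : Fin k) (i : Fin n) => y i j := by
    fun_prop
  have hV' := hcont.continuousAt (x := x) hV
  rw [Filter.mem_map, nhds_pi, Filter.mem_pi] at hV'
  obtain ⟨I, hI, t, ht, htV⟩ := hV'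
  have hO : IsOpen (⋂ i, {ν : ProbabilityMeasure (Fin k → X) |
      0 < (ν : Measure (Fin k → X)) (interior (t i))}) :=
    isOpen_iInter_of_finite fun i =>
      ProbabilityMeasure.isOpen_setOf_measure_pos isOpen_interior
  have hμO : μ ∈ ⋂ i, {ν : ProbabilityMeasure (Fin k → X) |
      0 < (ν : Measure (Fin k → X)) (interior (t i))} :=
    Set.mem_iInter.2 fun i => (Measure.mem_support_iff_forall _).1 (hx i) _
      (interior_mem_nhds.2 (ht i))
  obtain ⟨ν, hνO, hν⟩ := mem_closure_iff.1 hμ _ hO hμO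
  choose y hy using fun i => Measure.nonempty_inter_support_of_pos (Set.mem_iInter.1 hνO i)
  exact ⟨_, htV fun i _ => interior_subset (hy i).1, hν n hn y fun i => (hy i).2⟩

end ITMeasure

/-! ### Empirical measures and sampling. -/

section Empirical

variable {Z : Type*} [MeasurableSpace Z]

/-- The uniform average of the Dirac measures at the points `y 0, …, y n`. -/
noncomputable def empiricalMeasure {n : ℕ} (y : Fin (n + 1) → Z) : ProbabilityMeasure Z :=
  ⟨((n : ENNReal) + 1)⁻¹ • ∑ i, Measure.dirac (y i), ⟨by
    simp only [Measure.smul_apply, Measure.coe_finsetSum, Finset.sum_apply, measure_univ,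
      Finset.sum_const, Finset.card_univ, Fintype.card_fin, smul_eq_mul, nsmul_eq_mul, mul_one,
      Nat.cast_add, Nat.cast_one]
    exact ENNReal.inv_mul_cancel (by simp) (by finiteness)⟩⟩

variable [TopologicalSpace Z] [CompactSpace Z] [TopologicalSpace.MetrizableSpace Z] [BorelSpace Z]

theorem integral_empiricalMeasure {n : ℕ} (y : Fin (n + 1) → Z) (f : C(Z, ℝ)) :
    ∫ z, f z ∂(empiricalMeasure y : Measure Z) = (∑ i, f (y i)) / (n + 1) := by
  change ∫ z, f z ∂(((n : ENNReal) + 1)⁻¹ • ∑ i, Measure.dirac (y i)) = _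
  rw [integral_smul_measure, integral_finsetSum_measure
    fun i _ => f.integrable_of_compactSpace _]
  have : ((n : ENNReal) + 1).toReal = n + 1 := by
    rw [ENNReal.toReal_add (by finiteness) (by finiteness)]; simp
  simp [integral_dirac, this, div_eq_inv_mul]

theorem continuous_empiricalMeasure {n : ℕ} :
    Continuous (empiricalMeasure : (Fin (n + 1) → Z) → ProbabilityMeasure Z) := by
  rw [ProbabilityMeasure.continuous_iff_integral]
  intro f
  simp only [integral_empiricalMeasure]
  fun_prop

omit [CompactSpace Z] [TopologicalSpace.MetrizableSpace Z] in
theorem integral_map_continuousMap {Y : Type*} [MeasurableSpace Y] {ν : ProbabilityMeasure Y}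
    {φ : Y → Z} (hφ : AEMeasurable φ ν) (f : C(Z, ℝ)) :
    ∫ z, f z ∂(ν.map hφ : Measure Z) = ∫ y, f (φ y) ∂(ν : Measure Y) :=
  integral_map hφ f.continuous.aestronglyMeasurable

theorem smul_empiricalMeasure {Γ : Type*} [Group Γ] [MulAction Γ Z] [ContinuousConstSMul Γ Z]
    {n : ℕ} (s : Γ) (y : Fin (n + 1) → Z) :
    empiricalMeasure (s • y) = s • empiricalMeasure y := by
  refine ProbabilityMeasure.ext_integral_continuousMap fun f => ?_
  rw [integral_empiricalMeasure]
  have : ∫ z, f z ∂((s • empiricalMeasure y : ProbabilityMeasure Z) : Measure Z) =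
      ∫ z, f (s • z) ∂(empiricalMeasure y : Measure Z) :=
    integral_map_continuousMap _ f
  exact this.trans (integral_empiricalMeasure y ⟨fun z => f (s • z), by fun_prop⟩) |>.symm

/-- Sample independently from `μ`: almost every sequence stays in the support and obeys the strong
law for the finitely many test functions. -/
theorem mem_closure_empiricalMeasure (μ : ProbabilityMeasure Z) :
    μ ∈ closure {ν | ∃ (n : ℕ) (y : Fin (n + 1) → Z),
      (∀ i, y i ∈ (μ : Measure Z).support) ∧ ν = empiricalMeasure y} := by
  rw [mem_closure_iff_nhds]
  intro V hV
  obtain ⟨S, ε, hε, hS⟩ := ProbabilityMeasure.exists_finset_of_mem_nhds hV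
  let P := Measure.infinitePi fun _ : ℕ => (μ : Measure Z)
  have hev (i : ℕ) : MeasurePreserving (fun ω : ℕ → Z => ω i) P μ :=
    measurePreserving_eval_infinitePi _ i
  have hsupp : ∀ᵐ ω ∂P, ∀ i, ω i ∈ (μ : Measure Z).support :=
    ae_all_iff.2 fun i => (hev i).quasiMeasurePreserving.ae Measure.support_mem_ae
  have hlaw : ∀ᵐ ω ∂P, ∀ f ∈ S, Filter.Tendsto (fun n : ℕ => (∑ i ∈ Finset.range n, f (ω i)) / n)
      Filter.atTop (𝓝 (∫ z, f z ∂(μ : Measure Z))) := by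
    refine (ae_ball_iff S.countable_toSet).2 fun f _ => ?_
    have hident (i : ℕ) : ProbabilityTheory.IdentDistrib (fun ω : ℕ → Z => f (ω i))
        (fun ω => f (ω 0)) P P := by
      have : ProbabilityTheory.IdentDistrib (fun ω : ℕ → Z => ω i) (fun ω => ω 0) P P :=
        ⟨(hev i).measurable.aemeasurable, (hev 0).measurable.aemeasurable,
          (hev i).map_eq.trans (hev 0).map_eq.symm⟩
      exact this.comp f.continuous.measurable
    have hindep : Pairwise (Function.onFun (fun X Y => ProbabilityTheory.IndepFun X Y P)
        fun (i : ℕ) (ω : ℕ → Z) => f (ω i)) := fun i j hij =>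
      (ProbabilityTheory.iIndepFun_infinitePi (P := fun _ : ℕ => (μ : Measure Z))
        (X := fun _ z => f z) fun _ => f.continuous.measurable).indepFun hij
    have h := ProbabilityTheory.strong_law_ae_real (fun i (ω : ℕ → Z) => f (ω i))
      ((hev 0).integrable_comp_of_integrable (f.integrable_of_compactSpace _)) hindep hident
    have hint : ∫ ω, f (ω 0) ∂P = ∫ z, f z ∂(μ : Measure Z) := by
      rw [← (hev 0).map_eq, integral_map (hev 0).measurable.aemeasurable
        f.continuous.aestronglyMeasurable]
    rwa [hint] at h
  obtain ⟨ω, hω, hlim⟩ := (hsupp.and hlaw).exists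
  have hev : ∀ᶠ n : ℕ in Filter.atTop, ∀ f ∈ S,
      |(∑ i ∈ Finset.range n, f (ω i)) / n - ∫ z, f z ∂(μ : Measure Z)| < ε :=
    (Filter.eventually_all_finset S).2 fun f hf => by
      simpa [Real.dist_eq] using (hlim f hf).eventually (Metric.ball_mem_nhds _ hε)
  obtain ⟨n, hn⟩ := ((Filter.tendsto_add_atTop_nat 1).eventually hev).exists
  refine ⟨_, hS (empiricalMeasure fun i : Fin (n + 1) => ω i) fun f hf => ?_, n, _,
    fun i => hω i, rfl⟩
  simpa [integral_empiricalMeasure, Finset.sum_range] using hn f hf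

end Empirical

/-! ### Consequences of being an IT-measure. -/

section Marginal

variable {Γ X : Type*} [TopologicalSpace X] [CompactSpace X] [TopologicalSpace.MetrizableSpace X]
  [MeasurableSpace X] [BorelSpace X]

omit [CompactSpace X] [TopologicalSpace.MetrizableSpace X] in
theorem integral_marginal {k : ℕ} (μ : ProbabilityMeasure (Fin k → X)) (j : Fin k) (f : C(X, ℝ)) :
    ∫ x, f x ∂(marginal μ j : Measure X) = ∫ x, f (x j) ∂(μ : Measure (Fin k → X)) :=
  integral_map_continuousMap _ f

theorem continuous_marginal {k : ℕ} :
    Continuous fun (μ : ProbabilityMeasure (Fin k → X)) (j : Fin k) => marginal μ j :=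
  continuous_pi fun j => ProbabilityMeasure.continuous_map (continuous_apply j)

theorem marginal_empiricalMeasure {k n : ℕ} (y : Fin (n + 1) → Fin k → X) (j : Fin k) :
    marginal (empiricalMeasure y) j = empiricalMeasure fun i => y i j := by
  refine ProbabilityMeasure.ext_integral_continuousMap fun f => ?_
  rw [integral_marginal, integral_empiricalMeasure]
  exact integral_empiricalMeasure y ⟨fun x => f (x j), by fun_prop⟩

omit [TopologicalSpace.MetrizableSpace X] in
theorem toDualC_apply (μ : ProbabilityMeasure X) (f : C(X, ℝ)) :
    toDualC μ f = ∫ x, f x ∂(μ : Measure X) := rfl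

omit [TopologicalSpace.MetrizableSpace X] in
theorem continuous_toDualC : Continuous (toDualC : ProbabilityMeasure X → WeakDual ℝ C(X, ℝ)) :=
  WeakDual.continuous_of_continuous_eval fun f =>
    ProbabilityMeasure.continuous_integral_continuousMap f

theorem toDualC_empiricalMeasure {n : ℕ} (y : Fin (n + 1) → X) :
    toDualC (empiricalMeasure y) = ∑ i, ((n : ℝ) + 1)⁻¹ • toDualC (diracProba (y i)) := by
  refine WeakDual.toStrongDual.injective (ContinuousLinearMap.ext fun f => ?_)
  have hdirac (x : X) : toDualC (diracProba x) f = f x := integral_dirac f x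
  simp only [map_sum, map_smul, sum_apply, smul_apply,
    WeakDual.toStrongDual_apply, hdirac, toDualC_apply, integral_empiricalMeasure, smul_eq_mul,
    div_eq_inv_mul, Finset.mul_sum]

theorem marginal_mem_ITTuples [Group Γ] [MulAction Γ X] [ContinuousConstSMul Γ X] {k : ℕ}
    {μ : ProbabilityMeasure (Fin k → X)} (hμ : μ ∈ ITMeasures Γ X k) :
    (fun j => marginal μ j) ∈ ITTuples Γ (ProbabilityMeasure X) k := by
  refine closure_minimal ?_ ((isClosed_ITTuples k).preimage continuous_marginal)
    (mem_closure_empiricalMeasure μ)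
  rintro _ ⟨n, y, hy, rfl⟩
  simp only [Set.mem_preimage, marginal_empiricalMeasure]
  exact map_mem_ITTuples continuous_empiricalMeasure smul_empiricalMeasure
    (hμ (n + 1) (by omega) y hy)

omit [CompactSpace X] [TopologicalSpace.MetrizableSpace X] [BorelSpace X] in
theorem support_subset_ITTuples [Group Γ] [MulAction Γ X] [ContinuousConstSMul Γ X] {k : ℕ}
    {μ : ProbabilityMeasure (Fin k → X)} (hμ : μ ∈ ITMeasures Γ X k) :
    (μ : Measure (Fin k → X)).support ⊆ ITTuples Γ X k := fun x hx =>
  map_mem_ITTuples (φ := fun y : Fin 1 → X => y 0) (continuous_apply 0) (fun _ _ => rfl)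
    (hμ 1 le_rfl (fun _ => x) fun _ => hx)

theorem toDualC_marginal_mem_closedConvexHull [Group Γ] [MulAction Γ X] [ContinuousConstSMul Γ X]
    {k : ℕ} {μ : ProbabilityMeasure (Fin k → X)} (hμ : μ ∈ ITMeasures Γ X k) :
    (fun j => toDualC (marginal μ j)) ∈ closedConvexHull ℝ
      ((fun (x : Fin k → X) (j : Fin k) => toDualC (diracProba (x j))) '' ITTuples Γ X k) := by
  have hcont : Continuous fun (ν : ProbabilityMeasure (Fin k → X)) (j : Fin k) =>
      toDualC (marginal ν j) :=
    continuous_pi fun j => continuous_toDualC.comp ((continuous_apply j).comp continuous_marginal)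
  refine closure_minimal ?_ (isClosed_closedConvexHull.preimage hcont)
    (mem_closure_empiricalMeasure μ)
  rintro _ ⟨n, y, hy, rfl⟩
  have hsum : (fun j => toDualC (marginal (empiricalMeasure y) j)) =
      ∑ i, ((n : ℝ) + 1)⁻¹ • fun j => toDualC (diracProba (y i j)) := by
    funext j
    simp [marginal_empiricalMeasure, toDualC_empiricalMeasure]
  rw [Set.mem_preimage, hsum]
  refine convex_closedConvexHull.sum_mem (fun i _ => by positivity) ?_ fun i _ =>
    subset_closedConvexHull ⟨y i, support_subset_ITTuples hμ (hy i), rfl⟩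
  simp
  field_simp

/-- The support is nonempty, and a support point differing from `x` at `j` would make the `j`-th
marginal charge the complement of `x j`. -/
theorem mem_support_of_marginal_eq_diracProba {k : ℕ} {μ : ProbabilityMeasure (Fin k → X)}
    {x : Fin k → X} (h : ∀ j, marginal μ j = diracProba (x j)) :
    x ∈ (μ : Measure (Fin k → X)).support := by
  obtain ⟨y, hy⟩ := Measure.nonempty_support (μ := (μ : Measure (Fin k → X)))
    (IsProbabilityMeasure.ne_zero _)
  suffices y = x from this ▸ hy
  funext j
  by_contra hne
  have hpos : 0 < (marginal μ j : Measure X) {x j}ᶜ := by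
    change 0 < Measure.map (fun x => x j) (μ : Measure (Fin k → X)) _
    rw [Measure.map_apply (measurable_pi_apply j) (measurableSet_singleton _).compl]
    exact (Measure.mem_support_iff_forall _).1 hy _
      ((continuous_apply j).continuousAt (isOpen_compl_singleton.mem_nhds hne))
  rw [h] at hpos
  simp at hpos

omit [CompactSpace X] [TopologicalSpace.MetrizableSpace X] in
theorem smul_diracProba [Group Γ] [MulAction Γ X] [ContinuousConstSMul Γ X] (s : Γ) (x : X) :
    diracProba (s • x) = s • diracProba x :=
  ProbabilityMeasure.toMeasure_injective
    (Measure.map_dirac' (measurable_const_smul s) x).symm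

end Marginal

/-! ### Stable convergence of random points to a random measure. -/

section Stable

open ProbabilityTheory

variable {Ω X : Type*}
  [TopologicalSpace Ω] [CompactSpace Ω] [TopologicalSpace.MetrizableSpace Ω]
  [MeasurableSpace Ω] [BorelSpace Ω]
  [TopologicalSpace X] [CompactSpace X] [TopologicalSpace.MetrizableSpace X]
  [MeasurableSpace X] [BorelSpace X]

omit [MeasurableSpace X] [BorelSpace X] in
theorem exists_continuousMap_pos_iff_mem {U : Set X} (hU : IsOpen U) :
    ∃ f : C(X, ℝ), (∀ x, 0 ≤ f x) ∧ ∀ x, 0 < f x ↔ x ∈ U := by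
  let := TopologicalSpace.metrizableSpaceMetric X
  obtain ⟨f, hf, -, -, hf01⟩ := exists_continuous_one_zero_of_isCompact_of_isGδ
    hU.isClosed_compl.isCompact hU.isClosed_compl.isGδ isClosed_empty (Set.disjoint_empty _)
  refine ⟨1 - f, fun x => sub_nonneg.2 (hf01 x).2, fun x => ?_⟩
  have : x ∈ Uᶜ ↔ f x = 1 := by rw [hf]; rfl
  rw [← not_iff_not, ← Set.mem_compl_iff, this]
  simp only [ContinuousMap.sub_apply, ContinuousMap.one_apply, sub_pos, not_lt]
  exact ⟨fun h => le_antisymm (hf01 x).2 h, fun h => h.ge⟩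

/-- If `θ l → Θ` weakly with `θ l ≤ C • Θ`, then along an ultrafilter the random points `T l`
converge stably to a random measure `κ`. -/
theorem exists_kernel_tendsto_setIntegral [Nonempty X] {L : Type*} (F : Ultrafilter L)
    {Θ : ProbabilityMeasure Ω} {θ : L → ProbabilityMeasure Ω} {C : NNReal}
    (hle : ∀ l, (θ l : Measure Ω) ≤ C • (Θ : Measure Ω))
    (hlim : Filter.Tendsto θ F (𝓝 Θ)) (T : L → C(Ω, X)) :
    ∃ κ : Kernel Ω X, IsMarkovKernel κ ∧ ∀ (f : C(X, ℝ)) (B : Set Ω), MeasurableSet B →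
      Filter.Tendsto (fun l => ∫ ω in B, f (T l ω) ∂(θ l : Measure Ω)) F
        (𝓝 (∫ ω in B, ∫ x, f x ∂(κ ω) ∂(Θ : Measure Ω))) := by
  have : StandardBorelSpace X := by
    let := TopologicalSpace.metrizableSpaceMetric X
    infer_instance
  have hT (l : L) : Continuous fun ω => (ω, T l ω) := by fun_prop
  let ρs (l : L) : ProbabilityMeasure (Ω × X) := (θ l).map (hT l).measurable.aemeasurable
  obtain ⟨ρ, -, hρ⟩ := isCompact_univ.ultrafilter_le_nhds (F.map ρs) (by simp)
  have hρ : Filter.Tendsto ρs F (𝓝 ρ) := hρ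
  have hint (g : C(Ω × X, ℝ)) : Filter.Tendsto (fun l => ∫ ω, g (ω, T l ω) ∂(θ l : Measure Ω)) F
      (𝓝 (∫ p, g p ∂(ρ : Measure (Ω × X)))) := by
    have := ((ProbabilityMeasure.continuous_integral_continuousMap g).tendsto ρ).comp hρ
    exact this.congr fun l => integral_map_continuousMap _ g
  have hfst : (ρ : Measure (Ω × X)).fst = Θ := by
    have : ρ.map (f := Prod.fst) measurable_fst.aemeasurable = Θ := by
      refine ProbabilityMeasure.ext_integral_continuousMap fun h => ?_
      rw [integral_map_continuousMap]
      exact tendsto_nhds_unique (hint ⟨fun p => h p.1, by fun_prop⟩)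
        (((ProbabilityMeasure.continuous_integral_continuousMap h).tendsto Θ).comp hlim)
    exact congrArg Subtype.val this
  -- `κ` disintegrates the limiting joint law of `(ω, T l ω)` over its first marginal `Θ`.
  have hdis : (Θ : Measure Ω) ⊗ₘ (ρ : Measure (Ω × X)).condKernel = ρ := by
    rw [← hfst]
    exact Measure.disintegrate _ _
  set κ := (ρ : Measure (Ω × X)).condKernel
  refine ⟨κ, inferInstance, fun f B hB => ?_⟩
  have hcont (h : C(Ω, ℝ)) :
      Filter.Tendsto (fun l => ∫ ω, h ω * f (T l ω) ∂(θ l : Measure Ω)) F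
        (𝓝 (∫ ω, h ω * ∫ x, f x ∂(κ ω) ∂(Θ : Measure Ω))) := by
    let g : C(Ω × X, ℝ) := ⟨fun p => h p.1 * f p.2, by fun_prop⟩
    have hg := hint g
    rw [← hdis, Measure.integral_compProd (g.integrable_of_compactSpace _)] at hg
    simpa only [g, ContinuousMap.coe_mk, integral_const_mul] using hg
  have hfb (x : X) : |f x| ≤ ‖f‖ := f.norm_coe_le_norm x
  have hκb (ω : Ω) : |∫ x, f x ∂(κ ω)| ≤ ‖f‖ := by
    simpa using norm_integral_le_of_norm_le_const (μ := κ ω)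
      (Filter.Eventually.of_forall f.norm_coe_le_norm)
  have hκm : AEStronglyMeasurable (fun ω => ∫ x, f x ∂(κ ω)) (Θ : Measure Ω) :=
    (f.continuous.stronglyMeasurable.integral_kernel (κ := κ)).aestronglyMeasurable
  have hBi (ν : Measure Ω) [IsFiniteMeasure ν] : Integrable (B.indicator fun _ => (1 : ℝ)) ν :=
    (integrable_const 1).indicator hB
  -- comparison of the integral over `B` with the one against a continuous approximation
  have hcomp (ν : Measure Ω) [IsFiniteMeasure ν] (h : C(Ω, ℝ)) (u : Ω → ℝ)
      (hu : AEStronglyMeasurable u ν) (hub : ∀ ω, |u ω| ≤ ‖f‖) :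
      |∫ ω in B, u ω ∂ν - ∫ ω, h ω * u ω ∂ν| ≤
        ‖f‖ * ∫ ω, |B.indicator (fun _ => (1 : ℝ)) ω - h ω| ∂ν := by
    have hui : Integrable u ν := Integrable.of_bound hu ‖f‖ (Filter.Eventually.of_forall hub)
    have hhu : Integrable (fun ω => h ω * u ω) ν :=
      hui.bdd_mul h.continuous.aestronglyMeasurable
        (Filter.Eventually.of_forall h.norm_coe_le_norm)
    rw [← integral_indicator hB, ← integral_sub (hui.indicator hB) hhu, ← integral_const_mul]
    refine (abs_integral_le_integral_abs).trans (integral_mono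
      ((hui.indicator hB).sub hhu).abs
      ((((hBi ν).sub (h.integrable_of_compactSpace ν)).abs).const_mul _) fun ω => ?_)
    have : B.indicator u ω - h ω * u ω = u ω * (B.indicator (fun _ => (1 : ℝ)) ω - h ω) := by
      by_cases hω : ω ∈ B <;> simp [hω] <;> ring
    simp only [this, abs_mul]
    gcongr
    exact hub ω
  rw [Metric.tendsto_nhds]
  intro ε hε
  obtain ⟨δ, hδ, hδε⟩ : ∃ δ > 0, ‖f‖ * δ + ‖f‖ * (C * δ) ≤ ε / 2 := by
    have hpos : 0 < ‖f‖ + ‖f‖ * C + 1 := by positivity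
    refine ⟨ε / 2 / (‖f‖ + ‖f‖ * C + 1), by positivity, ?_⟩
    calc _ = (‖f‖ + ‖f‖ * C) * (ε / 2 / (‖f‖ + ‖f‖ * C + 1)) := by ring
      _ ≤ (‖f‖ + ‖f‖ * C + 1) * (ε / 2 / (‖f‖ + ‖f‖ * C + 1)) :=
        mul_le_mul_of_nonneg_right (by linarith) (by positivity)
      _ = ε / 2 := by field_simp
  obtain ⟨h', hh', -⟩ := (hBi (Θ : Measure Ω)).exists_boundedContinuous_integral_sub_le hδ
  let h : C(Ω, ℝ) := h'.toContinuousMap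
  have hΘ : ∫ ω, |B.indicator (fun _ => (1 : ℝ)) ω - h ω| ∂(Θ : Measure Ω) ≤ δ := hh'
  -- Domination by `C • Θ` makes the continuous approximation of the indicator of `B` uniform in
  -- `l`; this upgrades continuous weights to measurable `B`.
  have hθ (l : L) : ∫ ω, |B.indicator (fun _ => (1 : ℝ)) ω - h ω| ∂(θ l : Measure Ω) ≤ C * δ := by
    have hi := ((hBi (C • (Θ : Measure Ω))).sub (h.integrable_of_compactSpace _)).abs
    refine (integral_mono_measure (hle l) (Filter.Eventually.of_forall fun _ => abs_nonneg _)
      hi).trans ?_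
    rw [integral_smul_nnreal_measure]
    exact mul_le_mul_of_nonneg_left hΘ C.2
  have h1 := hcomp Θ h _ hκm hκb
  filter_upwards [(Metric.tendsto_nhds.1 (hcont h)) (ε / 2) (half_pos hε)] with l hl
  have h2 := hcomp (θ l) h (fun ω => f (T l ω)) (by fun_prop) fun ω => hfb _
  rw [Real.dist_eq] at hl ⊢
  have h1' := h1.trans (mul_le_mul_of_nonneg_left hΘ (norm_nonneg f))
  have h2' := h2.trans (mul_le_mul_of_nonneg_left (hθ l) (norm_nonneg f))
  rw [abs_le] at h1' h2'
  rw [abs_lt] at hl ⊢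
  constructor <;> linarith [h1'.1, h1'.2, h2'.1, h2'.2, hl.1, hl.2]

/-- Test stable convergence on a nonnegative `f` that is positive exactly on `U`; domination turns
positivity for `θ l` into positivity for `Θ`. -/
theorem eventually_measure_inter_preimage_pos {L : Type*} {F : Filter L}
    {Θ : ProbabilityMeasure Ω} {θ : L → ProbabilityMeasure Ω} {C : NNReal}
    (hle : ∀ l, (θ l : Measure Ω) ≤ C • (Θ : Measure Ω)) {T : L → C(Ω, X)}
    {κ : Kernel Ω X} [IsMarkovKernel κ]
    (hκ : ∀ (f : C(X, ℝ)) (B : Set Ω), MeasurableSet B →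
      Filter.Tendsto (fun l => ∫ ω in B, f (T l ω) ∂(θ l : Measure Ω)) F
        (𝓝 (∫ ω in B, ∫ x, f x ∂(κ ω) ∂(Θ : Measure Ω))))
    {B : Set Ω} (hB : MeasurableSet B) {U : Set X} (hU : IsOpen U)
    (hpos : 0 < (Θ : Measure Ω) (B ∩ {ω | 0 < κ ω U})) :
    ∀ᶠ l in F, 0 < (Θ : Measure Ω) (B ∩ T l ⁻¹' U) := by
  obtain ⟨f, hf0, hfU⟩ := exists_continuousMap_pos_iff_mem hU
  have hsupp : Function.support f = U := by
    ext x
    rw [← hfU, Function.mem_support, (hf0 x).lt_iff_ne, ne_comm]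
  have hκpos (ω : Ω) : 0 < ∫ x, f x ∂(κ ω) ↔ 0 < κ ω U := by
    rw [integral_pos_iff_support_of_nonneg hf0 (f.integrable_of_compactSpace _), hsupp]
  have hκ0 (ω : Ω) : 0 ≤ ∫ x, f x ∂(κ ω) := integral_nonneg hf0
  have hκi : Integrable (fun ω => ∫ x, f x ∂(κ ω)) (Θ : Measure Ω) := by
    refine Integrable.of_bound
      (f.continuous.stronglyMeasurable.integral_kernel (κ := κ)).aestronglyMeasurable ‖f‖
      (Filter.Eventually.of_forall fun ω => ?_)
    simpa using norm_integral_le_of_norm_le_const (μ := κ ω)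
      (Filter.Eventually.of_forall f.norm_coe_le_norm)
  have hlim : 0 < ∫ ω in B, ∫ x, f x ∂(κ ω) ∂(Θ : Measure Ω) := by
    rw [integral_pos_iff_support_of_nonneg hκ0 hκi.integrableOn, Measure.restrict_apply' hB]
    convert hpos using 2
    rw [Set.inter_comm]
    congr 1
    ext ω
    rw [Function.mem_support, Set.mem_ofPred_eq, ← hκpos, (hκ0 ω).lt_iff_ne, ne_comm]
  filter_upwards [(hκ f B hB).eventually (lt_mem_nhds hlim)] with l hl
  rw [integral_pos_iff_support_of_nonneg (fun ω => hf0 _)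
    (Integrable.integrableOn ((f.comp (T l)).integrable_of_compactSpace _)),
    Measure.restrict_apply' hB] at hl
  have hset : (Function.support fun ω => f (T l ω)) ∩ B = B ∩ T l ⁻¹' U := by
    rw [Set.inter_comm, ← hsupp]
    rfl
  rw [hset] at hl
  by_contra h0
  have h0 : (Θ : Measure Ω) (B ∩ T l ⁻¹' U) = 0 := by simpa using h0
  have := hle l (B ∩ T l ⁻¹' U)
  simp [h0] at this
  exact hl.ne' this

end Stable

/-! ### Mixtures of product measures are IT-measures. -/

section Mixture

open ProbabilityTheory

/-- A maximal `I` exists because the property has finite character; were it finite, `hstep` would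
supply a new element outside it. -/
theorem exists_infinite_forall_finset {L : Type*} [Infinite L] {F : Filter L} [F.NeBot]
    (hF : F ≤ Filter.cofinite) {P : Finset L → Prop} (h0 : P ∅)
    (hmono : ∀ J J', J' ⊆ J → P J → P J') [DecidableEq L]
    (hstep : ∀ J, P J → ∀ᶠ l in F, P (insert l J)) :
    ∃ I : Set L, I.Infinite ∧ ∀ J : Finset L, (J : Set L) ⊆ I → P J := by
  have hfin : Order.IsOfFiniteCharacter {I : Set L | ∀ J : Finset L, (J : Set L) ⊆ I → P J} := by
    intro I
    refine ⟨fun hI I' hI' _ J hJ => hI J (hJ.trans hI'), fun h J hJ => ?_⟩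
    exact h J hJ J.finite_toSet J subset_rfl
  obtain ⟨I, -, hI⟩ := hfin.exists_maximal (x := ∅) fun J hJ => by
    rwa [Finset.coe_eq_empty.1 (Set.subset_empty_iff.1 hJ)]
  refine ⟨I, fun hfinite => ?_, hI.prop⟩
  have hP := hI.prop hfinite.toFinset (by simp)
  obtain ⟨l, hl, hlI⟩ := ((hstep _ hP).and (hF hfinite.compl_mem_cofinite)).exists
  refine hlI (hI.le_of_ge (y := insert l I) (fun J hJ => hmono _ _ ?_ hl) (Set.subset_insert _ _)
    (Set.mem_insert _ _))
  intro a ha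
  have := hJ ha
  simpa using this

variable {Ω X : Type*} [MeasurableSpace Ω] [MeasurableSpace X]

theorem measurable_pi_kernel {ι : Type*} [Fintype ι] (κ : ι → Kernel Ω X)
    [∀ j, IsMarkovKernel (κ j)] : Measurable fun ω => Measure.pi fun j => κ j ω := by
  refine Measurable.measure_of_isPiSystem_of_isProbabilityMeasure
    generateFrom_pi.symm isPiSystem_pi ?_
  rintro _ ⟨t, ht, rfl⟩
  simp only [Measure.pi_pi]
  exact Finset.measurable_prod _ fun j _ => (κ j).measurable_coe (ht j trivial)

/-- The average over `Θ` of the product measures `∏ j, κ j ω`. -/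
noncomputable def mixture {k : ℕ} (Θ : ProbabilityMeasure Ω) (κ : Fin k → Kernel Ω X)
    [∀ j, IsMarkovKernel (κ j)] : ProbabilityMeasure (Fin k → X) :=
  ⟨(Θ : Measure Ω).bind fun ω => Measure.pi fun j => κ j ω, by
    refine ⟨?_⟩
    rw [Measure.bind_apply .univ (measurable_pi_kernel κ).aemeasurable]
    simp⟩

theorem mixture_apply {k : ℕ} (Θ : ProbabilityMeasure Ω) (κ : Fin k → Kernel Ω X)
    [∀ j, IsMarkovKernel (κ j)] {A : Set (Fin k → X)} (hA : MeasurableSet A) :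
    (mixture Θ κ : Measure (Fin k → X)) A =
      ∫⁻ ω, Measure.pi (fun j => κ j ω) A ∂(Θ : Measure Ω) :=
  Measure.bind_apply hA (measurable_pi_kernel κ).aemeasurable

theorem marginal_mixture {k : ℕ} (Θ : ProbabilityMeasure Ω) (κ : Fin k → Kernel Ω X)
    [∀ j, IsMarkovKernel (κ j)] (j : Fin k) :
    (marginal (mixture Θ κ) j : Measure X) = (Θ : Measure Ω).bind (κ j) := by
  ext A hA
  rw [Measure.bind_apply hA (κ j).measurable.aemeasurable]
  change Measure.map (fun x => x j) (mixture Θ κ : Measure (Fin k → X)) A = _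
  rw [Measure.map_apply (measurable_pi_apply j) hA, mixture_apply _ _ (measurable_pi_apply j hA)]
  congr 1 with ω
  exact (measurePreserving_eval (fun j => κ j ω) j).measure_preimage hA.nullMeasurableSet

theorem measure_setOf_forall_pos_of_mixture_pos {k : ℕ} {Θ : ProbabilityMeasure Ω}
    {κ : Fin k → Kernel Ω X} [∀ j, IsMarkovKernel (κ j)] {U : Fin k → Set X}
    (hU : ∀ j, MeasurableSet (U j))
    (hpos : 0 < (mixture Θ κ : Measure (Fin k → X)) (Set.pi Set.univ U)) :
    0 < (Θ : Measure Ω) {ω | ∀ j, 0 < κ j ω (U j)} := by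
  rw [mixture_apply _ _ (.univ_pi hU)] at hpos
  simp only [Measure.pi_pi] at hpos
  rw [lintegral_pos_iff_support
    (Finset.measurable_prod _ fun j _ => (κ j).measurable_coe (hU j))] at hpos
  convert hpos using 2
  ext ω
  simp [Finset.prod_eq_zero_iff, pos_iff_ne_zero]

/-- The invariant is that, for each support point and each colouring of `J`, the prescribed visits
have positive probability inside the event that every `κ j` charges its open set. Staying in that
event allows any colour at the next index. -/
theorem mixture_mem_ITMeasures {Γ : Type*} [TopologicalSpace X]
    [SecondCountableTopology X] [BorelSpace X] [SMul Γ X] [ContinuousConstSMul Γ X] {k : ℕ}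
    (hk : 1 ≤ k) {s : ℕ → Γ} (hs : s.Injective) {F : Filter ℕ} [F.NeBot]
    (hF : F ≤ Filter.cofinite)
    {Θ : ProbabilityMeasure Ω} {κ : Fin k → Kernel Ω X} [∀ j, IsMarkovKernel (κ j)]
    {p : Ω → X} (hp : Measurable p)
    (hκ : ∀ (j : Fin k) (B : Set Ω) (U : Set X), MeasurableSet B → IsOpen U →
      0 < (Θ : Measure Ω) (B ∩ {ω | 0 < κ j ω U}) →
        ∀ᶠ l in F, 0 < (Θ : Measure Ω) (B ∩ {ω | s l • p ω ∈ U})) :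
    mixture Θ κ ∈ ITMeasures Γ X k := by
  classical
  intro n _ x hx V hV
  obtain ⟨U, hUo, hxU, hUV⟩ : ∃ U : Fin n → Fin k → Set X, (∀ i j, IsOpen (U i j)) ∧
      (∀ i j, x i j ∈ U i j) ∧ ∀ j, Set.pi Set.univ (fun i => U i j) ⊆ V j := by
    simp only [nhds_pi, Filter.mem_pi] at hV
    choose I _ t ht htV using hV
    exact ⟨fun i j => interior (t j i), fun _ _ => isOpen_interior,
      fun i j => mem_interior_iff_mem_nhds.2 (ht j i),
      fun j y hy => htV j fun i _ => interior_subset (hy i trivial)⟩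
  have hUm (i j) : MeasurableSet (U i j) := (hUo i j).measurableSet
  let P (i : Fin n) : Set Ω := {ω | ∀ j, 0 < κ j ω (U i j)}
  have hP (i : Fin n) : MeasurableSet (P i) := by
    simp only [P, Set.ofPred_forall]
    exact .iInter fun j => measurableSet_lt measurable_const ((κ j).measurable_coe (hUm i j))
  let B (i : Fin n) (J : Finset ℕ) (τ : ℕ → Fin k) : Set Ω :=
    P i ∩ ⋂ l ∈ J, {ω | s l • p ω ∈ U i (τ l)}
  have hB (i J τ) : MeasurableSet (B i J τ) :=
    (hP i).inter (.biInter J.countable_toSet fun l _ =>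
      (hp.const_smul (s l)) (hUm i (τ l)))
  have hempty (i τ) : 0 < (Θ : Measure Ω) (B i ∅ τ) := by
    simp only [B, Finset.notMem_empty, Set.iInter_of_empty, Set.iInter_univ, Set.inter_univ]
    refine measure_setOf_forall_pos_of_mixture_pos (hUm i) ?_
    exact (Measure.mem_support_iff_forall _).1 (hx i) _
      (set_pi_mem_nhds Set.finite_univ fun j _ => (hUo i j).mem_nhds (hxU i j))
  have hmono (J J') (hJ : J' ⊆ J) (h : ∀ i τ, 0 < (Θ : Measure Ω) (B i J τ)) (i τ) :
      0 < (Θ : Measure Ω) (B i J' τ) := by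
    exact (h i τ).trans_le (measure_mono
      (Set.inter_subset_inter_right _ (Set.biInter_subset_biInter_left hJ)))
  have hstep (J) (hJ : ∀ i τ, 0 < (Θ : Measure Ω) (B i J τ)) :
      ∀ᶠ l in F, ∀ i τ, 0 < (Θ : Measure Ω) (B i (insert l J) τ) := by
    -- Only the colours on `J` matter, so finitely many eventual conditions suffice; the default
    -- colour is irrelevant.
    let ext (τ : J → Fin k) (l : ℕ) : Fin k := if h : l ∈ J then τ ⟨l, h⟩ else ⟨0, hk⟩
    have hev : ∀ᶠ l in F, ∀ (i : Fin n) (τ : J → Fin k) (j : Fin k),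
        0 < (Θ : Measure Ω) (B i J (ext τ) ∩ {ω | s l • p ω ∈ U i j}) := by
      simp only [Filter.eventually_all]
      intro i τ j
      refine hκ j _ _ (hB i J _) (hUo i j) ?_
      rw [Set.inter_eq_left.2 fun ω hω => hω.1 j]
      exact hJ i _
    filter_upwards [hev] with l hl i τ
    refine (hl i (fun a => τ a) (τ l)).trans_le (measure_mono fun ω hω => ⟨hω.1.1, ?_⟩)
    refine Set.mem_iInter₂.2 fun a ha => ?_
    rcases Finset.mem_insert.1 ha with rfl | ha
    · exact hω.2
    · have := Set.mem_iInter₂.1 hω.1.2 a ha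
      simpa [ext, ha] using this
  obtain ⟨I, hI, hIB⟩ := exists_infinite_forall_finset hF hempty hmono hstep
  refine ⟨s '' I, hI.image hs.injOn, fun J _ hJI σ => ?_⟩
  let τ (l : ℕ) : Fin k := if h : s l ∈ J then σ ⟨s l, h⟩ else ⟨0, hk⟩
  have hJ : ((J.preimage s hs.injOn : Finset ℕ) : Set ℕ) ⊆ I := fun l hl => by
    obtain ⟨l', hl', h⟩ := hJI (Finset.mem_coe.2 (Finset.mem_preimage.1 hl))
    exact hs h ▸ hl'
  -- Each coordinate of `X^n` gets its own `ω i`; only the index set `I` has to be common.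
  choose ω hω using fun i => nonempty_of_measure_ne_zero (hIB _ hJ i τ).ne'
  refine ⟨fun i => p (ω i), Set.mem_iInter.2 fun a => hUV _ fun i _ => ?_⟩
  obtain ⟨l, -, hl⟩ := hJI a.2
  have hlJ : s l ∈ J := hl ▸ a.2
  have := Set.mem_iInter₂.1 (hω i).2 l (Finset.mem_preimage.2 hlJ)
  have hτ : τ l = σ a := by
    simp only [τ, hlJ, dif_pos]
    congr 1
    exact Subtype.ext hl
  simpa [hτ, hl] using this

end Mixture

/-! ### Weak limits along pairwise independent events. -/

section WeakLimit

open ProbabilityTheory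

/-- Bessel's inequality after normalising. -/
theorem tendsto_inner_of_pairwise_orthogonal {H ι : Type*} [NormedAddCommGroup H]
    [InnerProductSpace ℝ H] {u : ι → H} {r : ℝ} (hr : ∀ i, ‖u i‖ = r)
    (hu : Pairwise fun i j => inner ℝ (u i) (u j) = 0) (v : H) :
    Filter.Tendsto (fun i => inner ℝ (u i) v) Filter.cofinite (𝓝 0) := by
  by_cases h0 : r = 0
  · have h0 (i : ι) : u i = 0 := norm_eq_zero.1 ((hr i).trans h0)
    simpa [h0] using tendsto_const_nhds
  have hon : Orthonormal ℝ fun i => r⁻¹ • u i := by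
    have hr0 (i : ι) : 0 ≤ r := hr i ▸ norm_nonneg _
    refine ⟨fun i => ?_, fun i j hij => ?_⟩
    · rw [norm_smul, hr, norm_inv, Real.norm_of_nonneg (hr0 i), inv_mul_cancel₀ h0]
    · simp [inner_smul_left, inner_smul_right, hu hij]
  have h := (hon.inner_products_summable v).tendsto_cofinite_zero
  have h' : Filter.Tendsto (fun i => inner ℝ (r⁻¹ • u i) v) Filter.cofinite (𝓝 0) := by
    rw [tendsto_zero_iff_norm_tendsto_zero]
    have := h.sqrt
    simpa [Real.sqrt_sq_eq_abs] using this
  have h'' := h'.const_mul r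
  simpa [inner_smul_left, mul_inv_cancel_left₀ h0] using h''

theorem tendsto_setIntegral_of_pairwise_independent {Ω ι : Type*} [MeasurableSpace Ω]
    {Θ : Measure Ω} [IsProbabilityMeasure Θ] {E : ι → Set Ω} (hE : ∀ i, MeasurableSet (E i))
    {c : ℝ} (hc : ∀ i, Θ.real (E i) = c) (hcc : Pairwise fun i j => Θ.real (E i ∩ E j) = c * c)
    {h : Ω → ℝ} (hh : MemLp h 2 Θ) :
    Filter.Tendsto (fun i => ∫ ω in E i, h ω ∂Θ) Filter.cofinite (𝓝 (c * ∫ ω, h ω ∂Θ)) := by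
  let e (A : Set Ω) (hA : MeasurableSet A) : Lp ℝ 2 Θ :=
    indicatorConstLp 2 hA (measure_ne_top Θ A) 1
  have hee (A B : Set Ω) (hA : MeasurableSet A) (hB : MeasurableSet B) :
      inner ℝ (e A hA) (e B hB) = Θ.real (A ∩ B) :=
    L2.real_inner_indicatorConstLp_one_indicatorConstLp_one hA hB
  -- Centred indicators are pairwise orthogonal and of constant norm.
  let u (i : ι) : Lp ℝ 2 Θ := e (E i) (hE i) - c • e Set.univ .univ
  have huu (i j : ι) : inner ℝ (u i) (u j) = Θ.real (E i ∩ E j) - c * c := by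
    simp only [u, inner_sub_left, inner_sub_right, inner_smul_left, inner_smul_right, hee,
      Set.inter_univ, Set.univ_inter, hc, conj_trivial, probReal_univ]
    ring
  have hnorm (i : ι) : ‖u i‖ = √(c - c * c) := by
    rw [norm_eq_sqrt_real_inner, huu, Set.inter_self, hc]
  have key := tendsto_inner_of_pairwise_orthogonal hnorm
    (fun i j hij => (huu i j).trans (by rw [hcc hij, sub_self])) (hh.toLp h)
  have he (A : Set Ω) (hA : MeasurableSet A) : inner ℝ (e A hA) (hh.toLp h) = ∫ ω in A, h ω ∂Θ := by
    rw [L2.inner_indicatorConstLp_one]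
    exact setIntegral_congr_ae hA (hh.coeFn_toLp.mono fun _ h _ => h)
  have hval (i : ι) : inner ℝ (u i) (hh.toLp h) = ∫ ω in E i, h ω ∂Θ - c * ∫ ω, h ω ∂Θ := by
    simp only [u, inner_sub_left, inner_smul_left, he, conj_trivial, setIntegral_univ]
  simp only [hval] at key
  simpa using key.add_const (c * ∫ ω, h ω ∂Θ)

end WeakLimit

theorem IsIndependenceSet.exists_forall_smul_mem {Γ Y : Type*} [SMul Γ Y] [Nonempty Y] {k : ℕ}
    {A : Fin k → Set Y} {F : Set Γ} (hF : IsIndependenceSet A F) {s : ℕ → Γ} (hs : s.Injective)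
    (hsF : ∀ l, s l ∈ F) (N : ℕ) (v : Fin N → Fin k) :
    ∃ y : Y, ∀ i : Fin N, s i • y ∈ A (v i) := by
  -- Independence only speaks of nonempty `J`, so `N = 0` is separate.
  rcases Nat.eq_zero_or_pos N with rfl | hN
  · exact ⟨Classical.arbitrary Y, fun i => i.elim0⟩
  let t : Fin N ↪ Γ := ⟨fun i => s i, hs.comp Fin.val_injective⟩
  have hmem (a : (Finset.univ.map t : Finset Γ)) : ∃ i, t i = a := by
    obtain ⟨i, -, hi⟩ := Finset.mem_map.1 a.2
    exact ⟨i, hi⟩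
  choose i hi using hmem
  obtain ⟨y, hy⟩ := hF (Finset.univ.map t) ⟨t ⟨0, hN⟩, by simp⟩
    (fun a ha => by
      obtain ⟨i, -, rfl⟩ := Finset.mem_map.1 ha
      exact hsF i) fun a => v (i a)
  refine ⟨y, fun m => ?_⟩
  have := Set.mem_iInter.1 hy ⟨t m, by simp⟩
  have him : i ⟨t m, by simp⟩ = m := t.injective (hi _)
  rw [him] at this
  exact this

/-! ### Coupling measures with random colourings. -/

section Coupling

open ProbabilityTheory

/-- The uniform Bernoulli measure on `k`-colourings of `ℕ`. -/
noncomputable def uniformColouring (k : ℕ) [NeZero k] : Measure (ℕ → Fin k) :=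
  Measure.infinitePi fun _ => (PMF.uniformOfFintype (Fin k)).toMeasure

instance (k : ℕ) [NeZero k] : IsProbabilityMeasure (uniformColouring k) :=
  inferInstanceAs (IsProbabilityMeasure (Measure.infinitePi _))

theorem uniformColouring_pi (k : ℕ) [NeZero k] (s : Finset ℕ) (j : Fin k) :
    (uniformColouring k).real {σ | ∀ l ∈ s, σ l = j} = ((k : ℝ)⁻¹) ^ s.card := by
  have : {σ : ℕ → Fin k | ∀ l ∈ s, σ l = j} = Set.pi s fun _ => {j} := by ext; simp [Set.mem_pi]
  rw [measureReal_def, this, uniformColouring,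
    Measure.infinitePi_pi _ fun _ _ => measurableSet_singleton _]
  simp

variable {X : Type*} [TopologicalSpace X] [CompactSpace X] [TopologicalSpace.MetrizableSpace X]
  [MeasurableSpace X] [BorelSpace X]

omit [CompactSpace X] [TopologicalSpace.MetrizableSpace X]
  [MeasurableSpace X] [BorelSpace X] in
theorem continuous_ite_colour {k : ℕ} (l : ℕ) (j : Fin k) (g : C(X, ℝ)) :
    Continuous fun ω : (ℕ → Fin k) × X => if ω.1 l = j then g ω.2 else 0 := by
  have h1 : Continuous fun a : Fin k => if a = j then (1 : ℝ) else 0 :=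
    continuous_of_discreteTopology
  have h2 : Continuous fun ω : (ℕ → Fin k) × X => (if ω.1 l = j then (1 : ℝ) else 0) * g ω.2 :=
    (h1.comp ((continuous_apply l).comp continuous_fst)).mul (g.continuous.comp continuous_snd)
  exact h2.congr fun ω => by split_ifs <;> simp

omit [TopologicalSpace X] [CompactSpace X]
  [TopologicalSpace.MetrizableSpace X] [BorelSpace X] in
theorem measurableSet_colour {k : ℕ} (l : ℕ) (j : Fin k) :
    MeasurableSet {ω : (ℕ → Fin k) × X | ω.1 l = j} :=
  measurable_fst (measurable_pi_apply l (measurableSet_singleton j) :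
    MeasurableSet ((fun σ : ℕ → Fin k => σ l) ⁻¹' {j}))

omit [TopologicalSpace X] [CompactSpace X]
  [TopologicalSpace.MetrizableSpace X] [BorelSpace X] in
theorem real_cylinder_of_fst_eq {k : ℕ} [NeZero k] {Θ : Measure ((ℕ → Fin k) × X)}
    (hΘ : Θ.fst = uniformColouring k) (j : Fin k) (t : Finset ℕ) :
    Θ.real {ω | ∀ l ∈ t, ω.1 l = j} = ((k : ℝ)⁻¹) ^ t.card := by
  rw [← uniformColouring_pi, ← hΘ, measureReal_def, measureReal_def, Measure.fst_apply]
  · rfl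
  · simp only [Set.ofPred_forall]
    exact .biInter t.countable_toSet fun l _ => measurableSet_eq_fun (by fun_prop) (by fun_prop)

/-- Measures attached to finite colourings are assembled to a measure on colourings of `ℕ`
times `X`. -/
theorem exists_coupling {k : ℕ} [NeZero k]
    (ν : ∀ N : ℕ, (Fin N → Fin k) → ProbabilityMeasure X) :
    ∃ Θ : ProbabilityMeasure ((ℕ → Fin k) × X), (Θ : Measure ((ℕ → Fin k) × X)).fst = uniformColouring k ∧
      ∀ (l : ℕ) (j : Fin k) (g : C(X, ℝ)) (ε : ℝ),
        (∀ N (hl : l < N) (v : Fin N → Fin k), v ⟨l, hl⟩ = j →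
          |∫ x, g x ∂(ν N v : Measure X)| ≤ ε) →
        |∫ ω in {ω : (ℕ → Fin k) × X | ω.1 l = j}, g ω.2 ∂(Θ : Measure ((ℕ → Fin k) × X))| ≤ ε * (k : ℝ)⁻¹ := by
  let κ (N : ℕ) : Kernel (ℕ → Fin k) X :=
    ⟨fun σ => (ν N fun i => σ i : Measure X),
      (measurable_of_finite fun v : Fin N → Fin k => (ν N v : Measure X)).comp
        (measurable_pi_lambda _ fun i => measurable_pi_apply (i : ℕ))⟩
  have hκ (N σ) : κ N σ = ν N fun i => σ i := rfl
  have hκM (N) : IsMarkovKernel (κ N) :=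
    ⟨fun σ => inferInstanceAs (IsProbabilityMeasure (ν N fun i => σ i : Measure X))⟩
  let Θs (N : ℕ) : ProbabilityMeasure ((ℕ → Fin k) × X) :=
    ⟨uniformColouring k ⊗ₘ κ N, inferInstance⟩
  obtain ⟨Θ, -, hΘ⟩ := isCompact_univ.ultrafilter_le_nhds
    ((Filter.hyperfilter ℕ).map Θs) (by simp)
  have hΘ : Filter.Tendsto Θs (Filter.hyperfilter ℕ) (𝓝 Θ) := hΘ
  refine ⟨Θ, ?_, fun l j g ε hg => ?_⟩
  · let lam : ProbabilityMeasure (ℕ → Fin k) := ⟨uniformColouring k, inferInstance⟩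
    have h1 := ((ProbabilityMeasure.continuous_map (continuous_fst (X := ℕ → Fin k)
      (Y := X))).tendsto Θ).comp hΘ
    have h2 (N : ℕ) : (Θs N).map continuous_fst.measurable.aemeasurable = lam :=
      ProbabilityMeasure.toMeasure_injective (Measure.fst_compProd _ _)
    have h3 := tendsto_nhds_unique (h1.congr h2) tendsto_const_nhds
    exact congrArg Subtype.val h3
  -- The colour event is clopen, so the truncated integrand is continuous and the bound survives the
  -- weak limit.
  let G : C((ℕ → Fin k) × X, ℝ) := ⟨_, continuous_ite_colour l j g⟩
  have hG (Θ' : Measure ((ℕ → Fin k) × X)) :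
      ∫ ω in {ω : (ℕ → Fin k) × X | ω.1 l = j}, g ω.2 ∂Θ' = ∫ ω, G ω ∂Θ' := by
    rw [← integral_indicator (measurableSet_colour l j)]
    congr 1 with ω
    by_cases hω : ω.1 l = j <;> simp [G, hω]
  rw [hG]
  have hlim := (((ProbabilityMeasure.continuous_integral_continuousMap G).tendsto Θ).comp hΘ).abs
  refine le_of_tendsto hlim ?_
  have hN : ∀ᶠ N in (Filter.hyperfilter ℕ : Filter ℕ), l < N :=
    (Nat.cofinite_eq_atTop ▸ Filter.hyperfilter_le_cofinite) (Filter.eventually_gt_atTop l)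
  filter_upwards [hN] with N hN
  change |∫ ω, G ω ∂(uniformColouring k ⊗ₘ κ N)| ≤ _
  rw [Measure.integral_compProd (G.integrable_of_compactSpace _)]
  have hA : MeasurableSet {σ : ℕ → Fin k | σ l = j} :=
    measurableSet_eq_fun (by fun_prop) (by fun_prop)
  have hreal : (uniformColouring k).real {σ | σ l = j} = (k : ℝ)⁻¹ := by
    simpa using uniformColouring_pi k {l} j
  have hbound : ∫ σ, {σ : ℕ → Fin k | σ l = j}.indicator (fun _ => ε) σ ∂(uniformColouring k) =
      ε * (k : ℝ)⁻¹ := by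
    rw [integral_indicator_const _ hA, hreal, smul_eq_mul, mul_comm]
  rw [← hbound, ← Real.norm_eq_abs]
  refine norm_integral_le_of_norm_le ((integrable_const ε).indicator hA)
    (Filter.Eventually.of_forall fun σ => ?_)
  by_cases hσ : σ l = j
  · simpa [G, hσ, hκ] using hg N hN (fun i => σ i) hσ
  · simp [G, hσ]

end Coupling

/-! ### From IT-tuples of measures to IT-measures. -/

section Approximation

open ProbabilityTheory

variable {Γ X : Type*} [TopologicalSpace X] [CompactSpace X] [TopologicalSpace.MetrizableSpace X]
  [MeasurableSpace X] [BorelSpace X] [Group Γ] [MulAction Γ X] [ContinuousConstSMul Γ X]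

/-- Conditioning on a colour event has density at most `k` and disappears in the weak limit, so
stable limits exist for each colour over the same base `Θ`. -/
theorem exists_mem_ITMeasures_of_coupling [Nonempty X] {k : ℕ} [NeZero k] {s : ℕ → Γ}
    (hs : s.Injective) {Θ : ProbabilityMeasure ((ℕ → Fin k) × X)}
    (hΘ : (Θ : Measure ((ℕ → Fin k) × X)).fst = uniformColouring k) :
    ∃ μ ∈ ITMeasures Γ X k, ∀ (j : Fin k) (f : C(X, ℝ)),
      Filter.Tendsto (fun l => k * ∫ ω in {ω : (ℕ → Fin k) × X | ω.1 l = j}, f (s l • ω.2) ∂(Θ : Measure ((ℕ → Fin k) × X)))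
        (Filter.hyperfilter ℕ) (𝓝 (∫ x, f x ∂(marginal μ j : Measure X))) := by
  have hk0 : (k : ℝ) ≠ 0 := Nat.cast_ne_zero.2 (NeZero.ne k)
  let E (j : Fin k) (l : ℕ) : Set ((ℕ → Fin k) × X) := {ω | ω.1 l = j}
  have hE (j l) : MeasurableSet (E j l) := measurableSet_colour l j
  have hEc (j l) : (Θ : Measure ((ℕ → Fin k) × X)).real (E j l) = (k : ℝ)⁻¹ := by
    simpa using real_cylinder_of_fst_eq hΘ j {l}
  have hEcc (j) : Pairwise fun l m =>
      (Θ : Measure ((ℕ → Fin k) × X)).real (E j l ∩ E j m) = (k : ℝ)⁻¹ * (k : ℝ)⁻¹ := by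
    intro l m hlm
    have := real_cylinder_of_fst_eq hΘ j {l, m}
    rw [Finset.card_pair hlm, pow_two] at this
    rw [← this]
    congr 1
    ext ω
    simp [E]
  have hlim (j : Fin k) (h : C((ℕ → Fin k) × X, ℝ)) :
      Filter.Tendsto (fun l => k * ∫ ω in E j l, h ω ∂(Θ : Measure ((ℕ → Fin k) × X)))
        (Filter.hyperfilter ℕ) (𝓝 (∫ ω, h ω ∂(Θ : Measure ((ℕ → Fin k) × X)))) := by
    have := (tendsto_setIntegral_of_pairwise_independent (hE j) (hEc j) (hEcc j)
      (MemLp.of_bound h.continuous.aestronglyMeasurable ‖h‖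
        (Filter.Eventually.of_forall h.norm_coe_le_norm))).const_mul (k : ℝ)
    rw [mul_inv_cancel_left₀ hk0] at this
    exact this.mono_left Filter.hyperfilter_le_cofinite
  have hEne (j l) : (Θ : Measure ((ℕ → Fin k) × X)) (E j l) ≠ 0 := fun h => by
    have := hEc j l
    rw [measureReal_def, h, ENNReal.toReal_zero] at this
    exact inv_ne_zero hk0 this.symm
  let θ (j : Fin k) (l : ℕ) : ProbabilityMeasure ((ℕ → Fin k) × X) :=
    ⟨(Θ : Measure ((ℕ → Fin k) × X))[|E j l], cond_isProbabilityMeasure (hEne j l)⟩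
  have hEinv (j l) : ((Θ : Measure ((ℕ → Fin k) × X)) (E j l))⁻¹ = k := by
    rw [← ENNReal.ofReal_toReal (measure_ne_top (Θ : Measure ((ℕ → Fin k) × X)) (E j l))]
    change (ENNReal.ofReal ((Θ : Measure ((ℕ → Fin k) × X)).real (E j l)))⁻¹ = k
    rw [hEc, ENNReal.ofReal_inv_of_pos (by positivity), inv_inv, ENNReal.ofReal_natCast]
  have hθ (j l) : (θ j l : Measure _) = (k : ENNReal) • (Θ : Measure ((ℕ → Fin k) × X)).restrict (E j l) := by
    rw [← hEinv j l]
    rfl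
  have hθint (j l) (g : (ℕ → Fin k) × X → ℝ) :
      ∫ ω, g ω ∂(θ j l : Measure _) = k * ∫ ω in E j l, g ω ∂(Θ : Measure ((ℕ → Fin k) × X)) := by
    rw [hθ, integral_smul_measure]
    simp
  have hle (j l) : (θ j l : Measure _) ≤ (k : NNReal) • (Θ : Measure ((ℕ → Fin k) × X)) := by
    rw [hθ]
    refine Measure.le_iff'.2 fun A => ?_
    have := Measure.restrict_le_self (μ := (Θ : Measure ((ℕ → Fin k) × X))) (s := E j l) A
    exact mul_le_mul_right this (k : ENNReal)
  have hθlim (j) : Filter.Tendsto (θ j) (Filter.hyperfilter ℕ) (𝓝 Θ) := by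
    rw [ProbabilityMeasure.isInducing_integral.tendsto_nhds_iff, tendsto_pi_nhds]
    intro h
    exact (hlim j h).congr fun l => (hθint j l h).symm
  let T (l : ℕ) : C((ℕ → Fin k) × X, X) := ⟨fun ω => s l • ω.2, by fun_prop⟩
  choose κ hκM hκ using fun j => exists_kernel_tendsto_setIntegral (Filter.hyperfilter ℕ)
    (hle j) (hθlim j) T
  refine ⟨mixture Θ κ, mixture_mem_ITMeasures (Nat.one_le_iff_ne_zero.2 (NeZero.ne k)) hs
    Filter.hyperfilter_le_cofinite measurable_snd fun j B U hB hU hpos =>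
      eventually_measure_inter_preimage_pos (hle j) (hκ j) hB hU hpos, fun j f => ?_⟩
  have h := hκ j f Set.univ .univ
  simp only [setIntegral_univ, hθint] at h
  have hmarg : ∫ x, f x ∂(marginal (mixture Θ κ) j : Measure X) =
      ∫ ω, ∫ x, f x ∂(κ j ω) ∂(Θ : Measure ((ℕ → Fin k) × X)) := by
    rw [marginal_mixture, ← Measure.snd_compProd, Measure.snd,
      integral_map measurable_snd.aemeasurable f.continuous.aestronglyMeasurable]
    exact Measure.integral_compProd (ContinuousMap.integrable_of_compactSpace _
      ⟨fun p : ((ℕ → Fin k) × X) × X => f p.2, by fun_prop⟩)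
  rwa [hmarg]

theorem ITTuples_subset_closure [Nonempty X] {k : ℕ} [NeZero k]
    {μ : Fin k → ProbabilityMeasure X} (hμ : μ ∈ ITTuples Γ (ProbabilityMeasure X) k) :
    μ ∈ closure ((fun (μ : ProbabilityMeasure (Fin k → X)) (j : Fin k) => marginal μ j) ''
      ITMeasures Γ X k) := by
  rw [mem_closure_iff_nhds]
  intro V hV
  obtain ⟨S, ε, hε, hS⟩ := ProbabilityMeasure.exists_finset_of_mem_nhds_pi hV
  obtain ⟨F, hF, hind⟩ := hμ (fun j => {ν | ∀ f ∈ S,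
      |∫ x, f x ∂(ν : Measure X) - ∫ x, f x ∂(μ j : Measure X)| < ε / 2}) fun j => by
    simp only [← Filter.eventually_iff, Filter.eventually_all_finset]
    intro f _
    simpa [Real.dist_eq] using
      (ProbabilityMeasure.continuous_integral_continuousMap f).continuousAt.eventually
        (Metric.ball_mem_nhds (∫ x, f x ∂(μ j : Measure X)) (half_pos hε))
  let s (l : ℕ) : Γ := hF.natEmbedding F l
  have hs : s.Injective := Subtype.val_injective.comp (hF.natEmbedding F).injective
  have : Nonempty (ProbabilityMeasure X) := ⟨μ 0⟩
  choose ν hν using fun N v => hind.exists_forall_smul_mem hs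
    (fun l => (hF.natEmbedding F l).2) N v
  obtain ⟨Θ, hΘ, hΘg⟩ := exists_coupling ν
  obtain ⟨m, hm, hlim⟩ := exists_mem_ITMeasures_of_coupling hs hΘ
  refine ⟨_, hS _ fun j f hf => ?_, m, hm, rfl⟩
  have hk0 : (0 : ℝ) < k := Nat.cast_pos.2 (NeZero.pos k)
  -- The limit only preserves the non-strict bound, hence the neighbourhoods of radius `ε / 2`.
  refine lt_of_le_of_lt (le_of_tendsto ((hlim j f).sub_const _).abs
    (Filter.Eventually.of_forall fun l => ?_)) (half_lt_self hε)
  let c := ∫ x, f x ∂(μ j : Measure X)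
  have h := hΘg l j ⟨fun x => f (s l • x) - c, by fun_prop⟩ (ε / 2) fun N hl v hv => by
    have hsmul : ∫ x, f x ∂((s l • ν N v : ProbabilityMeasure X) : Measure X) =
        ∫ x, f (s l • x) ∂(ν N v : Measure X) := integral_map_continuousMap _ f
    have := (hν N v ⟨l, hl⟩ f hf).le
    rw [hsmul, hv] at this
    simp only [ContinuousMap.coe_mk]
    have hfi : Integrable (fun x => f (s l • x)) (ν N v : Measure X) :=
      ContinuousMap.integrable_of_compactSpace _ ⟨fun x => f (s l • x), by fun_prop⟩
    rw [integral_sub hfi (integrable_const _)]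
    simpa [c] using this
  have hE : (Θ : Measure ((ℕ → Fin k) × X)).real {ω | ω.1 l = j} = (k : ℝ)⁻¹ := by
    simpa using real_cylinder_of_fst_eq hΘ j {l}
  simp only [ContinuousMap.coe_mk] at h
  have hfi : Integrable (fun ω : (ℕ → Fin k) × X => f (s l • ω.2))
      (Θ : Measure ((ℕ → Fin k) × X)) :=
    ContinuousMap.integrable_of_compactSpace _
      ⟨fun ω : (ℕ → Fin k) × X => f (s l • ω.2), by fun_prop⟩
  rw [integral_sub hfi.integrableOn (integrable_const _), setIntegral_const, hE, smul_eq_mul] at h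
  calc _ = |k * ((∫ ω in {ω : (ℕ → Fin k) × X | ω.1 l = j}, f (s l • ω.2) ∂(Θ : Measure ((ℕ → Fin k) × X))) - (k : ℝ)⁻¹ * c)| := by
        rw [mul_sub, mul_inv_cancel_left₀ hk0.ne']
    _ ≤ k * (ε / 2 * (k : ℝ)⁻¹) := by
        rw [abs_mul, abs_of_pos hk0]
        exact mul_le_mul_of_nonneg_left h hk0.le
    _ = ε / 2 := by field_simp

end Approximation

/-! ### The marginal description and the theorem. -/

section Main

variable {Γ X : Type*} [TopologicalSpace X] [CompactSpace X] [TopologicalSpace.MetrizableSpace X]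
  [MeasurableSpace X] [BorelSpace X] [Group Γ] [MulAction Γ X] [ContinuousConstSMul Γ X]

theorem ITTuples_probabilityMeasure_eq_image_marginal {k : ℕ} (hk : 1 ≤ k) :
    ITTuples Γ (ProbabilityMeasure X) k =
      (fun (μ : ProbabilityMeasure (Fin k → X)) (j : Fin k) => marginal μ j) ''
        ITMeasures Γ X k := by
  refine Set.Subset.antisymm (fun μ hμ => ?_) ?_
  · have : NeZero k := ⟨by omega⟩
    have : Nonempty X := (μ 0).nonempty
    have hclosed : IsClosed ((fun (μ : ProbabilityMeasure (Fin k → X)) (j : Fin k) =>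
        marginal μ j) '' ITMeasures Γ X k) :=
      ((isClosed_ITMeasures k).isCompact.image continuous_marginal).isClosed
    exact hclosed.closure_eq ▸ ITTuples_subset_closure hμ
  · rintro _ ⟨μ, hμ, rfl⟩
    exact marginal_mem_ITTuples hμ

end Main

theorem theorem1p7 {Γ : Type*} [Group Γ] [Countable Γ] [Infinite Γ]
    {X : Type*} [TopologicalSpace X] [CompactSpace X] [TopologicalSpace.MetrizableSpace X]
    [MeasurableSpace X] [BorelSpace X] [MulAction Γ X] [ContinuousConstSMul Γ X]
    (k : ℕ) (hk : 1 ≤ k) :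
    ((fun (μ : Fin k → ProbabilityMeasure X) (j : Fin k) => toDualC (μ j)) ''
          ITTuples Γ (ProbabilityMeasure X) k ⊆
        closedConvexHull ℝ
          ((fun (x : Fin k → X) (j : Fin k) => toDualC (diracProba (x j))) '' ITTuples Γ X k)) ∧
      (ITTuples Γ (ProbabilityMeasure X) k ∩
          Set.range (fun (x : Fin k → X) (j : Fin k) => diracProba (x j)) =
        (fun (x : Fin k → X) (j : Fin k) => diracProba (x j)) '' ITTuples Γ X k) ∧
      ITTuples Γ (ProbabilityMeasure X) k =
        (fun (μ : ProbabilityMeasure (Fin k → X)) (j : Fin k) => marginal μ j) ''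
          ITMeasures Γ X k := by
  have hIT := ITTuples_probabilityMeasure_eq_image_marginal (Γ := Γ) (X := X) hk
  refine ⟨?_, Set.Subset.antisymm ?_ ?_, hIT⟩
  · rw [hIT]
    rintro _ ⟨_, ⟨μ, hμ, rfl⟩, rfl⟩
    exact toDualC_marginal_mem_closedConvexHull hμ
  · rintro _ ⟨hx, x, rfl⟩
    rw [hIT] at hx
    obtain ⟨μ, hμ, hμx⟩ := hx
    exact ⟨x, support_subset_ITTuples hμ
      (mem_support_of_marginal_eq_diracProba fun j => congrFun hμx j), rfl⟩
  · rintro _ ⟨x, hx, rfl⟩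
    exact ⟨map_mem_ITTuples continuous_diracProba smul_diracProba hx, x, rfl⟩
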